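/- Let $p$ be a prime and $n\ge 1$, let $V_n=\mathbb F_p^n$, and write $\mathrm{GL}_n=\mathrm{GL}_n(\mathbb F_p)$. All modules are right $\mathbb F_p[\mathrm{GL}_n]$-modules. Let $\mathrm{GL}_{n-1}$ be regarded as a subgroup of $\mathrm{GL}_n$ via $g\mapsto\begin{pmatrix} g&0\\0&1\end{pmatrix}$ (with $\mathrm{GL}_0$ the trivial group), and let $\mathrm{Ind}_{\mathrm{GL}_{n-1}}^{\mathrm{GL}_n}(M)=M\otimes_{\mathbb F_p[\mathrm{GL}_{n-1}]}\mathbb F_p[\mathrm{GL}_n]$ be the induction functor. Let $\mathrm{St}_n$ be the Steinberg representation of $\mathrm{GL}_n$ over $\mathbb F_p$, that is, the right ideal of $\mathbb F_p[\mathrm{GL}_n]$ generated by $\bigl(\sum_{b\in B_n} b\bigr)\bigl(\sum_{w\in S_n}\mathrm{sgn}(w)\,w\bigr)$, where $B_n\subset\mathrm{GL}_n$ is the group of upper triangular matrices and $S_n\subset\mathrm{GL}_n$ the group of permutation matrices. Let $\mathcal J(V_n)$ be the quotient of the vector space $\mathbb F_p^{V_n}$ of all set maps $V_n\to\mathbb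 F_p$ by the subspace of constant maps, with right action $\phi\cdot g=\phi\circ g$, and let $\mathcal J(V_n)^\#$ be its contragredient, that is, the dual space $\mathcal J(V_n)^*$ with $(f\cdot g)(x)=f(x\cdot g^{-1})$. Tensor products over $\mathbb F_p$ carry the diagonal action. Then there is an isomorphism of $\mathbb F_p[\mathrm{GL}_n]$-modules $$\mathrm{Ind}_{\mathrm{GL}_{n-1}}^{\mathrm{GL}_n}(\mathrm{St}_{n-1})\;\cong\;\mathcal J(V_n)^\#\otimes \mathrm{St}_n .$$ -/

import Mathlib

namespace GLSteinberg

open scoped MonoidAlgebra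

noncomputable section

/-- The finite general linear group `GL_n(𝔽_p)`. -/
abbrev GLp (p n : ℕ) : Type := Matrix.GeneralLinearGroup (Fin n) (ZMod p)

/-- The group algebra `𝔽_p[GL_n(𝔽_p)]`. -/
abbrev GrpAlg (p n : ℕ) : Type := MonoidAlgebra (ZMod p) (GLp p n)

/-- The `GL_n(𝔽_p)`-modules considered here are right `𝔽_p[GL_n(𝔽_p)]`-modules, encoded as
representations of the opposite group: `ρ (MulOpposite.op g) x` stands for `x · g`. -/
abbrev RightRep (p n : ℕ) (M : Type) [AddCommGroup M] [Module (ZMod p) M] : Type :=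
  Representation (ZMod p) (GLp p n)ᵐᵒᵖ M

/-- The multiplicative map `A ↦ [A 0; 0 1]` from `n × n` to `(n+1) × (n+1)` matrices. -/
def blockHom (p n : ℕ) :
    Matrix (Fin n) (Fin n) (ZMod p) →* Matrix (Fin (n + 1)) (Fin (n + 1)) (ZMod p) where
  toFun A := Matrix.reindex finSumFinEquiv finSumFinEquiv
    (Matrix.fromBlocks A 0 0 (1 : Matrix (Fin 1) (Fin 1) (ZMod p)))
  map_one' := by simp
  map_mul' A B := by simp [Matrix.submatrix_mul_equiv, Matrix.fromBlocks_multiply]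

/-- The standard inclusion `GL_n(𝔽_p) → GL_{n+1}(𝔽_p)`, `g ↦ [g 0; 0 1]`. -/
def glIncl (p n : ℕ) : GLp p n →* GLp p (n + 1) := Units.map (blockHom p n)

/-- The permutation matrix of `w`, as an element of `GL_n(𝔽_p)`. -/
def permGL (p n : ℕ) : Equiv.Perm (Fin n) →* GLp p n :=
  (Matrix.permMatrixHom (R := ZMod p) (n := Fin n)).toHomUnits

open scoped Classical in
/-- The sum in the group algebra of the elements of the Borel subgroup of upper triangular
matrices. -/
def borelSum (p n : ℕ) [Fact p.Prime] : GrpAlg p n :=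
  ∑ b ∈ Finset.univ.filter
    (fun b : GLp p n => (b : Matrix (Fin n) (Fin n) (ZMod p)).IsUpperTriangular),
    MonoidAlgebra.single b 1

/-- The signed sum in the group algebra of the permutation matrices. -/
def signedPermSum (p n : ℕ) : GrpAlg p n :=
  ∑ w : Equiv.Perm (Fin n),
    MonoidAlgebra.single (permGL p n w) ((Equiv.Perm.sign w : ℤ) : ZMod p)

/-- Steinberg's element `(∑_{b ∈ B} b) (∑_w sgn(w) w)`; it is an invertible scalar times the
Steinberg idempotent. -/
def steinbergElt (p n : ℕ) [Fact p.Prime] : GrpAlg p n :=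
  borelSum p n * signedPermSum p n

/-- The right regular module: `x · g` is the product in the group algebra. -/
def rightRegular (p n : ℕ) : RightRep p n (GrpAlg p n) where
  toFun g := LinearMap.mulRight (ZMod p) (MonoidAlgebra.single g.unop 1)
  map_one' := by
    refine LinearMap.ext fun x => ?_
    simp [← MonoidAlgebra.one_def]
  map_mul' g h := by
    refine LinearMap.ext fun x => ?_
    simp [mul_assoc, MonoidAlgebra.single_mul_single]

/-- The right ideal `e 𝔽_p[GL_n(𝔽_p)]` generated by Steinberg's element `e`. -/
def steinbergIdeal (p n : ℕ) [Fact p.Prime] : Submodule (ZMod p) (GrpAlg p n) :=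
  LinearMap.range (LinearMap.mulLeft (ZMod p) (steinbergElt p n))

/-- The Steinberg representation `St_n` of `GL_n(𝔽_p)` over `𝔽_p`: the right ideal of the group
algebra generated by Steinberg's element. -/
def St (p n : ℕ) [Fact p.Prime] : RightRep p n (steinbergIdeal p n) :=
  (rightRegular p n).subrepresentation (steinbergIdeal p n) (by
    rintro g _ ⟨x, rfl⟩
    exact ⟨x * MonoidAlgebra.single g.unop 1, by simp [rightRegular, mul_assoc]⟩)

/-- The space of all set maps `V_n = 𝔽_p^n → 𝔽_p`. -/
abbrev Fun (p n : ℕ) : Type := (Fin n → ZMod p) → ZMod p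

/-- The right action of `GL_n(𝔽_p)` on set maps `V_n → 𝔽_p` by precomposition: `φ · g = φ ∘ g`. -/
def funRep (p n : ℕ) : RightRep p n (Fun p n) where
  toFun g := LinearMap.funLeft (ZMod p) (ZMod p)
    (fun v => (g.unop : Matrix (Fin n) (Fin n) (ZMod p)).mulVec v)
  map_one' := by
    refine LinearMap.ext fun φ => funext fun v => ?_
    simp [LinearMap.funLeft_apply]
  map_mul' g h := by
    refine LinearMap.ext fun φ => funext fun v => ?_
    simp [LinearMap.funLeft_apply, Matrix.mulVec_mulVec]

/-- The line of constant maps `V_n → 𝔽_p`. -/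
def constFun (p n : ℕ) : Submodule (ZMod p) (Fun p n) :=
  LinearMap.range (LinearMap.pi fun _ : Fin n → ZMod p => (LinearMap.id : ZMod p →ₗ[ZMod p] ZMod p))

/-- `J(V_n)`: the set maps `V_n → 𝔽_p` modulo the constant maps, with the right action induced by
precomposition. -/
def J (p n : ℕ) : RightRep p n (Fun p n ⧸ constFun p n) :=
  (funRep p n).quotient (constFun p n) (by
    rintro g _ ⟨c, rfl⟩
    exact ⟨c, rfl⟩)

/-- Induction of right modules along `GL_n(𝔽_p) → GL_{n+1}(𝔽_p)`, that is
`M ↦ M ⊗_{𝔽_p[GL_n]} 𝔽_p[GL_{n+1}]`. -/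
abbrev Ind (p n : ℕ) {M : Type} [AddCommGroup M] [Module (ZMod p) M] (ρ : RightRep p n M) :
    RightRep p (n + 1) (Representation.IndV (MonoidHom.op (glIncl p n)) ρ) :=
  Representation.ind (MonoidHom.op (glIncl p n)) ρ

end

end GLSteinberg

/-!
The contragredient `J(V_{n+1})^#` has a basis indexed by the nonzero vectors, which `GL_{n+1}`
permutes transitively, so `J(V_{n+1})^# ⊗ St_{n+1}` is induced from the restriction of `St_{n+1}`
to the stabilizer `P` of the last basis vector. It remains to see that this restriction is induced
from `St_n` along `GL_n ≤ P`. Let `e` be Steinberg's element of `GL_{n+1}`.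

* The translates `e h` with `h ∈ P` span `e 𝔽_p[GL_{n+1}]`: for `x ≠ 0`, the transvections satisfy
  `e = e T_{ij}(x) + e T_{ji}(x⁻¹)`, and a suitable `x` makes each of the two terms reduce the
  number of nonzero entries in the last column.
* The translates of `St_n` by distinct cosets of `GL_n` in `P` are independent, because the
  restriction of coefficients from `GL_{n+1}` to `GL_n` maps `e y` to `e_n y` for
  `y ∈ 𝔽_p[GL_n]`, and kills `e y h` for `h ∈ P` outside `GL_n`.
-/

namespace GLSteinberg

open scoped MonoidAlgebra TensorProduct

noncomputable section

section InducedRepresentations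

open Representation

section

variable {k G H A : Type*} [CommRing k] [Group G] [Group H] [AddCommGroup A] [Module k A]
  (φ : G →* H) (ρ : Representation k G A)

lemma indV_mk_map_mul (g : G) (h : H) (a : A) :
    IndV.mk φ ρ (φ g * h) (ρ g a) = IndV.mk φ ρ h a :=
  (Coinvariants.mk_eq_iff _).2 <| Coinvariants.mem_ker_of_eq g (.single h 1 ⊗ₜ a) _ (by simp)

lemma exists_finsupp_sum_indV_mk_eq (z : IndV φ ρ) :
    ∃ c : H ⧸ φ.range →₀ A, (c.sum fun q a => IndV.mk φ ρ q.out⁻¹ a) = z := by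
  let Φ : (H ⧸ φ.range →₀ A) →ₗ[k] IndV φ ρ := Finsupp.lsum k fun q => IndV.mk φ ρ q.out⁻¹
  suffices hΦ : LinearMap.range Φ = ⊤ from LinearMap.range_eq_top.1 hΦ z
  rw [← Submodule.ker_mkQ (LinearMap.range Φ), LinearMap.ker_eq_top]
  refine IndV.hom_ext φ ρ fun h => LinearMap.ext fun a => (Submodule.Quotient.mk_eq_zero _).2 ?_
  obtain ⟨⟨_, g, rfl⟩, hg⟩ := QuotientGroup.mk_out_eq_mul φ.range h⁻¹
  refine ⟨Finsupp.single (h⁻¹ : H) (ρ g⁻¹ a), ?_⟩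
  rw [← indV_mk_map_mul φ ρ g⁻¹ h a]
  simp [Φ, hg]

end

universe u v

variable {k H A B : Type u} {G : Type v} [CommRing k] [Group G] [Group H] [AddCommGroup A]
  [Module k A] [AddCommGroup B] [Module k B] {φ : G →* H} {ρ : Representation k G A}
  {τ : Representation k H B}

lemma exists_intertwiningMap_ind (f : IntertwiningMap ρ (τ.comp φ)) :
    ∃ F : IntertwiningMap (ind φ ρ) τ, ∀ h a, F (IndV.mk φ ρ h a) = τ h⁻¹ (f a) := by
  refine ⟨((Rep.indResHomEquiv φ (Rep.of ρ) (Rep.of τ)).symm (Rep.ofHom f)).hom, fun h a => ?_⟩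
  simp

theorem nonempty_ind_equiv {C : Type*} [AddCommMonoid C] [Module k C]
    (f : IntertwiningMap ρ (τ.comp φ)) (r : B →ₗ[k] C)
    (hspan : ⨆ h, LinearMap.range (τ h ∘ₗ f.toLinearMap) = ⊤)
    (hinj : Function.Injective (r ∘ₗ f.toLinearMap))
    (hzero : ∀ h ∉ φ.range, r ∘ₗ τ h ∘ₗ f.toLinearMap = 0) :
    Nonempty ((ind φ ρ).Equiv τ) := by
  obtain ⟨F, hF⟩ := exists_intertwiningMap_ind f
  refine ⟨F.ofBijective ⟨(injective_iff_map_eq_zero F).2 fun z hz => ?_, ?_⟩⟩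
  · obtain ⟨c, rfl⟩ := exists_finsupp_sum_indV_mk_eq φ ρ z
    have hsum : (c.sum fun q a => τ q.out (f a)) = 0 := by
      simpa only [map_finsuppSum, hF, inv_inv] using hz
    suffices hc : c = 0 by rw [hc, Finsupp.sum_zero_index]
    ext q
    have hq : (c.sum fun q' a => r (τ (q.out⁻¹ * q'.out) (f a))) = r (f (c q)) := by
      rw [Finsupp.sum_eq_single q]
      · simp
      · intro q' _ hne
        refine LinearMap.congr_fun (hzero _ fun hmem => hne ?_) (c q')
        simpa using (QuotientGroup.eq.2 hmem).symm
      · simp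
    refine (map_eq_zero_iff (r ∘ₗ f.toLinearMap) hinj).1 (hq.symm.trans ?_)
    simpa [map_finsuppSum] using congrArg (r ∘ₗ τ q.out⁻¹) hsum
  · suffices hF_top : LinearMap.range F.toLinearMap = ⊤ from LinearMap.range_eq_top.1 hF_top
    rw [eq_top_iff, ← hspan, iSup_le_iff]
    rintro h _ ⟨a, rfl⟩
    exact ⟨IndV.mk φ ρ h⁻¹ a, by simpa using hF h⁻¹ a⟩

end InducedRepresentations

section GroupAlgebra

open MonoidAlgebra

variable {k G H : Type*} [CommSemiring k] [Group G] [Group H]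

theorem exists_eq_mul_sum_of [Fintype G] {φ : G →* H} (hφ : Function.Injective φ) {x : k[H]}
    (hx : ∀ g, x * of k H (φ g) = x) : ∃ d, x = d * ∑ g, of k H (φ g) := by
  classical
  have hcoeff (h : H) (g : G) : x.coeff (h * (φ g)⁻¹) = x.coeff h := by
    conv_rhs => rw [← hx g]
    simp
  -- Keep the coefficients of `x` at one representative of each coset.
  refine ⟨.ofCoeff (x.coeff.filter fun h => (h : H ⧸ φ.range).out = h), ?_⟩
  ext h
  obtain ⟨⟨_, g, rfl⟩, hg⟩ := QuotientGroup.mk_out_eq_mul φ.range h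
  have hout (g' : G) : (h : H ⧸ φ.range).out = h * (φ g')⁻¹ ↔ g⁻¹ = g' := by
    rw [hg, mul_right_inj, ← map_inv, hφ.eq_iff, eq_inv_iff_mul_eq_one, inv_eq_iff_mul_eq_one]
  simp [Finset.mul_sum, Finsupp.filter_apply, hout, hcoeff]

lemma coeff_mul_mapDomain_eq_zero (φ : G →* H) {x : k[H]} {h : H}
    (hx : ∀ g, x.coeff (h * φ g) = 0) (y : k[G]) : (x * mapDomain φ y).coeff h = 0 := by
  induction y using MonoidAlgebra.induction_linear with
  | zero => simp
  | add y z hy hz => simp [mapDomain_add, mul_add, hy, hz]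
  | single g r => simp [← map_inv, hx]

/-- Restriction along an injective group homomorphism of the elements of a group algebra, viewed as
functions on the group. -/
def restrictCoeff (φ : G →* H) (hφ : Function.Injective φ) : k[H] →ₗ[k] k[G] where
  toFun := comapDomain φ hφ
  map_add' x y := by simp
  map_smul' r x := by ext; simp

lemma coeff_restrictCoeff {φ : G →* H} (hφ : Function.Injective φ) (x : k[H]) (g : G) :
    (restrictCoeff φ hφ x).coeff g = x.coeff (φ g) := by
  simp [restrictCoeff]

lemma restrictCoeff_mul_mapDomain {φ : G →* H} (hφ : Function.Injective φ) (x : k[H]) (y : k[G]) :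
    restrictCoeff φ hφ (x * mapDomain φ y) = restrictCoeff φ hφ x * y := by
  induction y using MonoidAlgebra.induction_linear with
  | zero => simp
  | add y z hy hz => simp [mapDomain_add, mul_add, hy, hz]
  | single g r => ext; simp [coeff_restrictCoeff]

end GroupAlgebra

section SteinbergElement

variable {p n : ℕ}

/-- The group element `g` as an element of the group algebra. -/
abbrev δ : GLp p n →* GrpAlg p n := MonoidAlgebra.of (ZMod p) (GLp p n)

/-- The Borel subgroup of upper triangular matrices. -/
def borel (p n : ℕ) : Subgroup (GLp p n) where
  carrier := {b | (b : Matrix (Fin n) (Fin n) (ZMod p)).IsUpperTriangular}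
  mul_mem' ha hb := Matrix.BlockTriangular.mul ha hb
  one_mem' := Matrix.blockTriangular_one
  inv_mem' {b} hb := by
    have : Invertible (b : Matrix (Fin n) (Fin n) (ZMod p)) := b.invertible
    rw [Set.mem_ofPred_eq, Matrix.GeneralLinearGroup.coe_inv]
    exact Matrix.blockTriangular_inv_of_blockTriangular hb

lemma permGL_apply (w : Equiv.Perm (Fin n)) (r c : Fin n) :
    permGL p n w r c = if r = w c then 1 else 0 := by
  change w⁻¹.permMatrix (ZMod p) r c = _
  simp [Equiv.Perm.permMatrix, PEquiv.toMatrix_apply, Equiv.toPEquiv_apply,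
    Equiv.eq_symm_apply, eq_comm]

lemma permGL_mul_apply (w : Equiv.Perm (Fin n)) (g : GLp p n) (r c : Fin n) :
    (permGL p n w * g) r c = g (w⁻¹ r) c := by
  simp [Matrix.mul_apply, permGL_apply, ← Equiv.Perm.inv_eq_iff_eq]

lemma mul_permGL_apply (g : GLp p n) (w : Equiv.Perm (Fin n)) (r c : Fin n) :
    (g * permGL p n w) r c = g r (w c) := by
  simp [Matrix.mul_apply, permGL_apply]

lemma permGL_smul (w : Equiv.Perm (Fin n)) (v : Fin n → ZMod p) :
    permGL p n w • v = v ∘ ⇑w⁻¹ := by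
  change (w⁻¹.permMatrix (ZMod p)).mulVec v = _
  exact Matrix.permMatrix_mulVec _

/-- The elementary matrix `1 + x E_{ij}` as an element of the general linear group. -/
abbrev transvectionGL {i j : Fin n} (hij : i ≠ j) (x : ZMod p) : GLp p n :=
  Matrix.SpecialLinearGroup.transvection hij x

lemma transvectionGL_apply {i j : Fin n} (hij : i ≠ j) (x : ZMod p) (r c : Fin n) :
    transvectionGL hij x r c = (if r = c then 1 else 0) + if i = r ∧ j = c then x else 0 := by
  simp [Matrix.SpecialLinearGroup.transvection, Matrix.transvection, Matrix.one_apply,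
    Matrix.single_apply]

lemma transvectionGL_smul {i j : Fin n} (hij : i ≠ j) (x : ZMod p) (v : Fin n → ZMod p) :
    transvectionGL hij x • v = Function.update v i (v i + x * v j) := by
  change (Matrix.transvection i j x).mulVec v = _
  ext r
  obtain rfl | hr := eq_or_ne r i <;>
    simp_all [Matrix.transvection, Matrix.add_mulVec, Matrix.single_mulVec]

variable [Fact p.Prime]

open scoped Classical in
lemma borelSum_eq_sum : borelSum p n = ∑ b : borel p n, δ (b : GLp p n) :=
  Finset.sum_subtype _ (by simp [borel]) _

open scoped Classical in
lemma coeff_borelSum (g : GLp p n) :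
    (borelSum p n).coeff g = if g ∈ borel p n then 1 else 0 := by
  rw [borelSum, MonoidAlgebra.coeff_sum, Finsupp.finsetSum_apply]
  simp [Finsupp.single_apply, borel]

lemma borelSum_mul_of_mem_borel {b : GLp p n} (hb : b ∈ borel p n) :
    borelSum p n * δ b = borelSum p n := by
  classical
  ext g
  simp [coeff_borelSum, mul_mem_cancel_right (inv_mem hb)]

lemma borelSum_mul_permGL_mul {w : Equiv.Perm (Fin n)} {g : GLp p n}
    (hg : ∀ r c, w c < w r → g r c = 0) :
    borelSum p n * δ (permGL p n w * g) = borelSum p n * δ (permGL p n w) := by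
  have hmem : permGL p n w * g * permGL p n w⁻¹ ∈ borel p n := fun r c hrc => by
    rw [mul_permGL_apply, permGL_mul_apply]
    exact hg _ _ (by simpa using hrc)
  conv_rhs => rw [← borelSum_mul_of_mem_borel hmem]
  simp only [mul_assoc, ← map_mul, inv_mul_cancel, map_one, mul_one]

lemma steinbergElt_eq_sum : steinbergElt p n = ∑ w : Equiv.Perm (Fin n),
    ((Equiv.Perm.sign w : ℤ) : ZMod p) • (borelSum p n * δ (permGL p n w)) := by
  simp [steinbergElt, signedPermSum, Finset.mul_sum, ← mul_smul_comm]

lemma steinbergElt_mul_of_diagonal {t : GLp p n} (ht : t.1.IsDiag) :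
    steinbergElt p n * δ t = steinbergElt p n := by
  simp only [steinbergElt_eq_sum, Finset.sum_mul, smul_mul_assoc, mul_assoc, ← map_mul]
  refine Finset.sum_congr rfl fun w _ => ?_
  rw [borelSum_mul_permGL_mul fun r c hrc => ht ?_]
  rintro rfl
  exact lt_irrefl _ hrc

lemma steinbergElt_mul_permGL (s : Equiv.Perm (Fin n)) :
    steinbergElt p n * δ (permGL p n s) =
      ((Equiv.Perm.sign s : ℤ) : ZMod p) • steinbergElt p n := by
  simp only [steinbergElt_eq_sum, Finset.sum_mul, Finset.smul_sum, smul_mul_assoc, mul_assoc,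
    ← map_mul, smul_smul]
  refine Fintype.sum_equiv (Equiv.mulRight s) _ _ fun w => ?_
  have hsign : Equiv.Perm.sign s * Equiv.Perm.sign (w * s) = Equiv.Perm.sign w := by
    rw [Equiv.Perm.sign_mul, mul_comm, mul_assoc, Int.units_mul_self, mul_one]
  rw [Equiv.coe_mulRight, ← Int.cast_mul, ← Units.val_mul, hsign]

lemma borelSum_mul_permGL_mul_transvectionGL {w : Equiv.Perm (Fin n)} {i j : Fin n} (hij : i ≠ j)
    (hw : w i < w j) (x : ZMod p) :
    borelSum p n * δ (permGL p n w * transvectionGL hij x) = borelSum p n * δ (permGL p n w) := by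
  refine borelSum_mul_permGL_mul fun r c hrc => ?_
  rw [transvectionGL_apply, if_neg, if_neg, add_zero]
  · rintro ⟨rfl, rfl⟩
    exact lt_asymm hrc hw
  · rintro rfl
    exact lt_irrefl _ hrc

lemma borelSum_mul_permGL_mul_swap_mul_transvectionGL {w : Equiv.Perm (Fin n)} {i j : Fin n}
    (hij : i ≠ j) (hw : w i < w j) {x : ZMod p} (hx : x ≠ 0) :
    borelSum p n * δ (permGL p n w * permGL p n (Equiv.swap i j) * transvectionGL hij x) =
      borelSum p n * δ (permGL p n w * transvectionGL hij.symm x⁻¹) := by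
  -- In rank two, `s T_{12}(x) T_{21}(-x⁻¹)` is upper triangular.
  have hk (r c) (hrc : w c < w r) : (permGL p n (Equiv.swap i j) * (transvectionGL hij x *
      transvectionGL hij.symm (-x⁻¹))) r c = 0 := by
    rw [permGL_mul_apply, Equiv.swap_inv]
    change (Matrix.transvection i j x * Matrix.transvection j i (-x⁻¹)) _ _ = 0
    have hcr : c ≠ r := fun h => hrc.ne (congrArg w h)
    obtain rfl | hri := eq_or_ne r i
    · have hcj : c ≠ j := fun h => hrc.not_gt (h ▸ hw)
      rw [Equiv.swap_apply_left, Matrix.transvection_mul_apply_of_ne _ _ _ _ hij.symm]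
      simp [Matrix.transvection, hcr.symm, hcj.symm]
    obtain rfl | hrj := eq_or_ne r j
    · rw [Equiv.swap_apply_right, Matrix.transvection_mul_apply_same]
      obtain rfl | hci := eq_or_ne c i
      · simp [Matrix.transvection, hij.symm, hx]
      · simp [Matrix.transvection, hci.symm, hcr.symm]
    · rw [Equiv.swap_apply_of_ne_of_ne hri hrj, Matrix.transvection_mul_apply_of_ne _ _ _ _ hri]
      simp [Matrix.transvection, hcr.symm, hrj.symm]
  have key := congrArg (· * δ (transvectionGL hij.symm x⁻¹)) (borelSum_mul_permGL_mul hk)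
  have hinv : transvectionGL hij.symm (-x⁻¹) * transvectionGL hij.symm x⁻¹ = 1 := by
    simp [← map_mul, ← Matrix.SpecialLinearGroup.transvection_inv]
  simpa only [mul_assoc, ← map_mul δ, hinv, mul_one] using key

lemma borelSum_mul_permGL_mul_one_sub_of_lt {w : Equiv.Perm (Fin n)} {i j : Fin n} (hij : i ≠ j)
    (hw : w i < w j) {x : ZMod p} (hx : x ≠ 0) :
    borelSum p n * δ (permGL p n w) *
        (1 - δ (transvectionGL hij x) - δ (transvectionGL hij.symm x⁻¹)) =
      borelSum p n * δ (permGL p n (w * Equiv.swap i j)) *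
        (1 - δ (transvectionGL hij x) - δ (transvectionGL hij.symm x⁻¹)) := by
  have hT := borelSum_mul_permGL_mul_transvectionGL hij hw x
  have hsT := borelSum_mul_permGL_mul_swap_mul_transvectionGL hij hw hx
  have hsT' := borelSum_mul_permGL_mul_transvectionGL (w := w * Equiv.swap i j) hij.symm
    (by simpa using hw) x⁻¹
  simp only [mul_sub, mul_one, mul_assoc, ← map_mul δ, map_mul (permGL p n)] at hT hsT hsT' ⊢
  rw [hT, hsT, hsT']
  abel

lemma borelSum_mul_permGL_mul_one_sub (w : Equiv.Perm (Fin n)) {i j : Fin n} (hij : i ≠ j)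
    {x : ZMod p} (hx : x ≠ 0) :
    borelSum p n * δ (permGL p n w) *
        (1 - δ (transvectionGL hij x) - δ (transvectionGL hij.symm x⁻¹)) =
      borelSum p n * δ (permGL p n (w * Equiv.swap i j)) *
        (1 - δ (transvectionGL hij x) - δ (transvectionGL hij.symm x⁻¹)) := by
  obtain h | h := (w.injective.ne hij).lt_or_gt
  · exact borelSum_mul_permGL_mul_one_sub_of_lt hij h hx
  · rw [borelSum_mul_permGL_mul_one_sub_of_lt (w := w * Equiv.swap i j) hij (by simpa using h) hx,
      mul_assoc w, Equiv.swap_mul_self, mul_one]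

theorem steinbergElt_eq_add {i j : Fin n} (hij : i ≠ j) {x : ZMod p} (hx : x ≠ 0) :
    steinbergElt p n = steinbergElt p n * δ (transvectionGL hij x) +
      steinbergElt p n * δ (transvectionGL hij.symm x⁻¹) := by
  suffices h : steinbergElt p n *
      (1 - δ (transvectionGL hij x) - δ (transvectionGL hij.symm x⁻¹)) = 0 by
    simpa only [mul_sub, mul_one, sub_sub, sub_eq_zero, mul_add] using h
  rw [steinbergElt_eq_sum, Finset.sum_mul]
  refine Finset.sum_involution (fun w _ => w * Equiv.swap i j) (fun w _ => ?_) (fun w _ _ => ?_)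
    (fun _ _ => Finset.mem_univ _) (fun w _ => by simp [mul_assoc])
  · rw [smul_mul_assoc, smul_mul_assoc, ← borelSum_mul_permGL_mul_one_sub w hij hx,
      Equiv.Perm.sign_mul, Equiv.Perm.sign_swap hij]
    simp
  · simpa using hij

lemma steinbergElt_mul_eq_add_of_smul_ne_zero {i j : Fin n} (hij : i ≠ j) (g : GLp p n)
    {v : Fin n → ZMod p} (hi : (g • v) i ≠ 0) (hj : (g • v) j ≠ 0) :
    ∃ g₁ g₂ : GLp p n, g₁ • v = Function.update (g • v) i 0 ∧
      g₂ • v = Function.update (g • v) j 0 ∧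
      steinbergElt p n * δ g = steinbergElt p n * δ g₁ + steinbergElt p n * δ g₂ := by
  have hx : -((g • v) i / (g • v) j) ≠ 0 := neg_ne_zero.2 (div_ne_zero hi hj)
  refine ⟨transvectionGL hij (-((g • v) i / (g • v) j)) * g,
    transvectionGL hij.symm (-((g • v) i / (g • v) j))⁻¹ * g, ?_, ?_, ?_⟩
  · rw [mul_smul, transvectionGL_smul]
    congr 1
    field_simp
    ring
  · rw [mul_smul, transvectionGL_smul]
    congr 1
    field_simp
    ring
  · conv_lhs => rw [steinbergElt_eq_add hij hx]
    simp only [add_mul, mul_assoc, map_mul]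

/-- The stabilizer in `GL_n(𝔽_p)` of the `l`-th standard basis vector. -/
abbrev basisStabilizer (p : ℕ) {n : ℕ} (l : Fin n) : Subgroup (GLp p n) :=
  MulAction.stabilizer (GLp p n) (Pi.single l 1 : Fin n → ZMod p)

lemma exists_basisStabilizer_steinbergElt_mul_eq_smul {g : GLp p n} {l i : Fin n} {a : ZMod p}
    (ha : a ≠ 0) (hg : g • (Pi.single l 1 : Fin n → ZMod p) = Pi.single i a) :
    ∃ (c : ZMod p) (h : basisStabilizer p l),
      steinbergElt p n * δ g = c • (steinbergElt p n * δ (h : GLp p n)) := by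
  let t : GLp p n := Matrix.GeneralLinearGroup.scalar (Fin n) (Units.mk0 a ha)⁻¹
  let s : GLp p n := permGL p n (Equiv.swap i l)
  have hmem : t * (s * g) ∈ basisStabilizer p l := by
    rw [MulAction.mem_stabilizer_iff, mul_smul, mul_smul, hg, permGL_smul]
    change (Matrix.scalar (Fin n) a⁻¹).mulVec _ = _
    ext r
    simp [Matrix.mulVec_diagonal, Pi.single_apply, Equiv.swap_apply_eq_iff, ha]
  have ht : t.1.IsDiag := Matrix.isDiag_diagonal _
  refine ⟨((Equiv.Perm.sign (Equiv.swap i l) : ℤ) : ZMod p), ⟨_, hmem⟩, ?_⟩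
  rw [map_mul, map_mul, ← mul_assoc, steinbergElt_mul_of_diagonal ht, ← mul_assoc,
    steinbergElt_mul_permGL, smul_mul_assoc, smul_smul, ← Int.cast_mul, ← Units.val_mul,
    Int.units_mul_self, Units.val_one, Int.cast_one, one_smul]

/-- The map `x ↦ e x` from the group algebra onto its right ideal generated by Steinberg's
element `e`. -/
def stProj (p n : ℕ) [Fact p.Prime] : GrpAlg p n →ₗ[ZMod p] steinbergIdeal p n :=
  (LinearMap.mulLeft (ZMod p) (steinbergElt p n)).rangeRestrict

lemma stProj_surjective : Function.Surjective (stProj p n) :=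
  LinearMap.surjective_rangeRestrict _

lemma stProj_mem_span_basisStabilizer (l : Fin n) (g : GLp p n) :
    stProj p n (δ g) ∈ Submodule.span (ZMod p)
      (Set.range fun h : basisStabilizer p l => stProj p n (δ (h : GLp p n))) := by
  set u : Fin n → ZMod p := Pi.single l 1
  induction hm : (Function.support (g • u)).ncard using Nat.strong_induction_on generalizing g with
  | _ m ih =>
  subst hm
  obtain ⟨i, hi⟩ : ∃ i, (g • u) i ≠ 0 := Function.ne_iff.1 ((smul_ne_zero_iff_ne g).2 (by simp [u]))
  by_cases hj : ∃ j, i ≠ j ∧ (g • u) j ≠ 0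
  · obtain ⟨j, hij, hj⟩ := hj
    obtain ⟨g₁, g₂, hg₁, hg₂, h⟩ := steinbergElt_mul_eq_add_of_smul_ne_zero hij g hi hj
    have hlt (k) (hk : (g • u) k ≠ 0) : (Function.support (Function.update (g • u) k 0)).ncard <
        (Function.support (g • u)).ncard := by
      rw [Function.support_update_zero]
      exact Set.ncard_sdiff_singleton_lt_of_mem hk
    rw [show stProj p n (δ g) = stProj p n (δ g₁) + stProj p n (δ g₂) from Subtype.ext h]
    exact add_mem (ih _ (hg₁ ▸ hlt i hi) g₁ rfl) (ih _ (hg₂ ▸ hlt j hj) g₂ rfl)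
  · push Not at hj
    have hgu : g • u = Pi.single i ((g • u) i) := by
      ext j
      obtain rfl | hne := eq_or_ne j i
      · simp
      · simp [hne, hj j hne.symm]
    obtain ⟨c, h, hc⟩ := exists_basisStabilizer_steinbergElt_mul_eq_smul hi hgu
    rw [show stProj p n (δ g) = c • stProj p n (δ (h : GLp p n)) from Subtype.ext hc]
    exact Submodule.smul_mem _ c (Submodule.subset_span ⟨h, rfl⟩)

theorem span_stProj_basisStabilizer (l : Fin n) : Submodule.span (ZMod p)
    (Set.range fun h : basisStabilizer p l => stProj p n (δ (h : GLp p n))) = ⊤ := by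
  rw [Submodule.eq_top_iff', stProj_surjective.forall]
  intro x
  induction x using MonoidAlgebra.induction_linear with
  | zero => simp
  | add x y hx hy => rw [map_add]; exact add_mem hx hy
  | single g c =>
    rw [← mul_one c, ← smul_eq_mul, ← MonoidAlgebra.smul_single, map_smul]
    exact Submodule.smul_mem _ c (stProj_mem_span_basisStabilizer l g)


end SteinbergElement

section Inclusion

variable {p n : ℕ}

lemma glIncl_apply_castSucc_castSucc (a : GLp p n) (r c : Fin n) :
    glIncl p n a r.castSucc c.castSucc = a r c := by
  simp [glIncl, blockHom, Fin.castSucc]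

lemma glIncl_apply_castSucc_last (a : GLp p n) (r : Fin n) :
    glIncl p n a r.castSucc (Fin.last n) = 0 := by
  simp [glIncl, blockHom, Fin.castSucc, finSumFinEquiv_symm_last]

lemma glIncl_apply_last_castSucc (a : GLp p n) (c : Fin n) :
    glIncl p n a (Fin.last n) c.castSucc = 0 := by
  simp [glIncl, blockHom, Fin.castSucc, finSumFinEquiv_symm_last]

lemma glIncl_apply_last_last (a : GLp p n) : glIncl p n a (Fin.last n) (Fin.last n) = 1 := by
  simp [glIncl, blockHom, finSumFinEquiv_symm_last]

lemma glIncl_injective : Function.Injective (glIncl p n) := fun a b h => by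
  ext r c
  rw [← glIncl_apply_castSucc_castSucc a, h, glIncl_apply_castSucc_castSucc]

lemma glIncl_mem_borel_iff {a : GLp p n} : glIncl p n a ∈ borel p (n + 1) ↔ a ∈ borel p n := by
  refine ⟨fun h r c hrc => ?_, fun h r c => ?_⟩
  · rw [← glIncl_apply_castSucc_castSucc]
    exact h (Fin.castSucc_lt_castSucc_iff.2 hrc)
  · cases r using Fin.lastCases <;> cases c using Fin.lastCases
    · simp
    · simp [glIncl_apply_last_castSucc]
    · simp [glIncl_apply_castSucc_last]
    · rw [glIncl_apply_castSucc_castSucc]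
      exact fun hrc => h (Fin.castSucc_lt_castSucc_iff.1 hrc)

lemma mem_basisStabilizer_iff {l : Fin n} {g : GLp p n} :
    g ∈ basisStabilizer p l ↔ ∀ r, g r l = (Pi.single l 1 : Fin n → ZMod p) r := by
  rw [MulAction.mem_stabilizer_iff, funext_iff]
  change (∀ r, g.1.mulVec _ r = _) ↔ _
  simp

lemma mem_range_glIncl_iff {g : GLp p (n + 1)} : g ∈ (glIncl p n).range ↔
    g ∈ basisStabilizer p (Fin.last n) ∧ ∀ c : Fin n, g (Fin.last n) c.castSucc = 0 := by
  rw [mem_basisStabilizer_iff]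
  constructor
  · rintro ⟨a, rfl⟩
    refine ⟨fun r => ?_, glIncl_apply_last_castSucc a⟩
    cases r using Fin.lastCases with
    | last => simp [glIncl_apply_last_last]
    | cast r => simp [glIncl_apply_castSucc_last]
  · rintro ⟨hcol, hrow⟩
    set A : Matrix (Fin n) (Fin n) (ZMod p) := g.1.submatrix Fin.castSucc Fin.castSucc
    have hblock : blockHom p n A = g.1 := by
      ext r c
      cases c using Fin.lastCases with
      | last =>
        rw [hcol]
        cases r using Fin.lastCases with
        | last => simp [blockHom, finSumFinEquiv_symm_last]
        | cast r =>
          rw [Pi.single_eq_of_ne (Fin.castSucc_ne_last r)]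
          simp [blockHom, finSumFinEquiv_symm_last, Fin.castSucc]
      | cast c =>
        cases r using Fin.lastCases
        · rw [hrow]
          simp [blockHom, finSumFinEquiv_symm_last, Fin.castSucc]
        · simp [blockHom, A, Fin.castSucc]
    have hdet : (blockHom p n A).det = A.det := by
      simp [blockHom, Matrix.det_submatrix_equiv_self]
    have hA : IsUnit A.det := by
      rw [← hdet, hblock]
      exact (Matrix.isUnit_iff_isUnit_det _).1 g.isUnit
    exact ⟨Matrix.GeneralLinearGroup.mk'' A hA, Units.ext hblock⟩

lemma glIncl_mem_basisStabilizer (a : GLp p n) :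
    glIncl p n a ∈ basisStabilizer p (Fin.last n) :=
  (mem_range_glIncl_iff.1 ⟨a, rfl⟩).1

lemma mem_range_glIncl_of_mem_borel {h : GLp p (n + 1)} (hh : h ∈ basisStabilizer p (Fin.last n))
    (hb : h ∈ borel p (n + 1)) : h ∈ (glIncl p n).range :=
  mem_range_glIncl_iff.2 ⟨hh, fun c => hb c.castSucc_lt_last⟩

/-- The homomorphism of group algebras induced by `glIncl`. -/
abbrev glInclAlg (p n : ℕ) : GrpAlg p n →ₐ[ZMod p] GrpAlg p (n + 1) :=
  MonoidAlgebra.mapDomainAlgHom (ZMod p) (ZMod p) (glIncl p n)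

lemma glInclAlg_of (g : GLp p n) : glInclAlg p n (δ g) = δ (glIncl p n g) := by
  simp

/-- The extension of a permutation of `Fin n` to `Fin (n + 1)` fixing the last element. -/
def extPerm (σ : Equiv.Perm (Fin n)) : Equiv.Perm (Fin (n + 1)) :=
  σ.viaFintypeEmbedding Fin.castSuccEmb

lemma extPerm_castSucc (σ : Equiv.Perm (Fin n)) (i : Fin n) :
    extPerm σ i.castSucc = (σ i).castSucc :=
  σ.viaFintypeEmbedding_apply_image Fin.castSuccEmb i

lemma extPerm_last (σ : Equiv.Perm (Fin n)) : extPerm σ (Fin.last n) = Fin.last n :=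
  σ.viaFintypeEmbedding_apply_notMem_range Fin.castSuccEmb (by simp)

lemma sign_extPerm (σ : Equiv.Perm (Fin n)) :
    Equiv.Perm.sign (extPerm σ) = Equiv.Perm.sign σ :=
  σ.viaFintypeEmbedding_sign Fin.castSuccEmb

lemma permGL_extPerm (σ : Equiv.Perm (Fin n)) :
    permGL p (n + 1) (extPerm σ) = glIncl p n (permGL p n σ) := by
  ext r c
  rw [permGL_apply]
  cases c using Fin.lastCases <;> cases r using Fin.lastCases <;>
    simp [extPerm_last, extPerm_castSucc, glIncl_apply_last_last, glIncl_apply_castSucc_last,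
      glIncl_apply_last_castSucc, glIncl_apply_castSucc_castSucc, permGL_apply,
      (Fin.castSucc_ne_last _).symm]

/-- The coset representatives of the permutations fixing the last element: `lastCycle i` sends the
last element to `i` and is increasing on the other elements. -/
abbrev lastCycle (i : Fin (n + 1)) : Equiv.Perm (Fin (n + 1)) := Fin.cycleIcc i (Fin.last n)

lemma lastCycle_last (i : Fin (n + 1)) : lastCycle i (Fin.last n) = i :=
  Fin.cycleIcc_of_last i.le_last

lemma lastCycle_castSucc (i : Fin (n + 1)) (j : Fin n) :
    lastCycle i j.castSucc = i.succAbove j := by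
  simpa using congrFun (Fin.cycleIcc_comp_succAbove i (Fin.last n) i.le_last) j

lemma lastCycle_mul_extPerm_bijective :
    Function.Bijective fun x : Fin (n + 1) × Equiv.Perm (Fin n) => lastCycle x.1 * extPerm x.2 := by
  rw [Fintype.bijective_iff_injective_and_card]
  refine ⟨?_, by simp [Fintype.card_perm, Nat.factorial_succ]⟩
  rintro ⟨i, σ⟩ ⟨j, τ⟩ h
  obtain rfl : i = j := by
    simpa [extPerm_last, lastCycle_last] using Equiv.congr_fun h (Fin.last n)
  have hστ : extPerm σ = extPerm τ := mul_left_cancel h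
  refine Prod.ext rfl (Equiv.ext fun k => ?_)
  simpa [extPerm_castSucc] using Equiv.congr_fun hστ k.castSucc

lemma signedPermSum_succ : signedPermSum p (n + 1) =
    (∑ i : Fin (n + 1), ((Equiv.Perm.sign (lastCycle i) : ℤ) : ZMod p) •
      δ (permGL p (n + 1) (lastCycle i))) * glInclAlg p n (signedPermSum p n) := by
  rw [signedPermSum, ← Fintype.sum_bijective _ lastCycle_mul_extPerm_bijective _ _ fun _ => rfl,
    Fintype.sum_prod_type, signedPermSum, map_sum, Finset.sum_mul_sum]
  refine Finset.sum_congr rfl fun i _ => Finset.sum_congr rfl fun σ _ => ?_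
  simp [permGL_extPerm, sign_extPerm, MonoidAlgebra.single_mul_single]

variable [Fact p.Prime]

/-- The product of the sum over the Borel subgroup of `GL_{n+1}(𝔽_p)` and the signed sum of the
`lastCycle`s: the left factor that turns `signedPermSum p n` into Steinberg's element. -/
def lastCycleSum (p n : ℕ) [Fact p.Prime] : GrpAlg p (n + 1) :=
  borelSum p (n + 1) * ∑ i : Fin (n + 1),
    ((Equiv.Perm.sign (lastCycle i) : ℤ) : ZMod p) • δ (permGL p (n + 1) (lastCycle i))

lemma steinbergElt_succ :
    steinbergElt p (n + 1) = lastCycleSum p n * glInclAlg p n (signedPermSum p n) := by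
  rw [steinbergElt, signedPermSum_succ, ← mul_assoc, lastCycleSum]

lemma lastCycleSum_mul_glIncl {b : GLp p n} (hb : b ∈ borel p n) :
    lastCycleSum p n * δ (glIncl p n b) = lastCycleSum p n := by
  simp only [lastCycleSum, Finset.mul_sum, Finset.sum_mul, mul_smul_comm, smul_mul_assoc,
    mul_assoc, ← map_mul δ]
  refine Finset.sum_congr rfl fun i _ => ?_
  rw [borelSum_mul_permGL_mul fun r c => ?_]
  cases r using Fin.lastCases <;> cases c using Fin.lastCases
  · simp
  · simp [glIncl_apply_last_castSucc]
  · simp [glIncl_apply_castSucc_last]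
  · rw [lastCycle_castSucc, lastCycle_castSucc, glIncl_apply_castSucc_castSucc]
    exact fun h => hb (Fin.succAbove_lt_succAbove_iff.1 h)

lemma exists_steinbergElt_succ_eq_mul :
    ∃ d, steinbergElt p (n + 1) = d * glInclAlg p n (steinbergElt p n) := by
  classical
  have hinj : Function.Injective ((glIncl p n).comp (borel p n).subtype) :=
    glIncl_injective.comp (borel p n).subtype_injective
  obtain ⟨d, hd⟩ := exists_eq_mul_sum_of hinj fun b => lastCycleSum_mul_glIncl b.2
  refine ⟨d, ?_⟩
  rw [steinbergElt_succ, hd, steinbergElt, map_mul, ← mul_assoc, borelSum_eq_sum, map_sum]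
  simp only [glInclAlg_of]
  rfl

open scoped Classical in
lemma coeff_lastCycleSum {h : GLp p (n + 1)} (hh : h ∈ basisStabilizer p (Fin.last n)) :
    (lastCycleSum p n).coeff h = if h ∈ borel p (n + 1) then 1 else 0 := by
  have hcoeff (w : Equiv.Perm (Fin (n + 1))) : (borelSum p (n + 1) * δ (permGL p (n + 1) w)).coeff h
      = if h * permGL p (n + 1) w⁻¹ ∈ borel p (n + 1) then 1 else 0 := by
    simp [coeff_borelSum]
  simp only [lastCycleSum, Finset.mul_sum, mul_smul_comm, MonoidAlgebra.coeff_sum,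
    Finsupp.finsetSum_apply, MonoidAlgebra.coeff_smul_apply, hcoeff]
  rw [Finset.sum_eq_single (Fin.last n)]
  · simp only [Fin.cycleIcc_eq, inv_one, map_one, mul_one, Units.val_one, Int.cast_one, one_smul]
  · intro i _ hi
    rw [if_neg fun hb => ?_, smul_zero]
    have hentry : (h * permGL p (n + 1) (lastCycle i)⁻¹) (Fin.last n) i = 0 :=
      hb (Fin.lt_last_iff_ne_last.2 hi)
    rw [mul_permGL_apply, Equiv.Perm.inv_eq_iff_eq.2 (lastCycle_last i).symm,
      mem_basisStabilizer_iff.1 hh, Pi.single_eq_same] at hentry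
    exact one_ne_zero hentry
  · simp

lemma restrictCoeff_steinbergElt_mul_glInclAlg (x : GrpAlg p n) :
    restrictCoeff (glIncl p n) glIncl_injective (steinbergElt p (n + 1) * glInclAlg p n x) =
      steinbergElt p n * x := by
  classical
  have hrestrict : restrictCoeff (glIncl p n) glIncl_injective (lastCycleSum p n) =
      borelSum p n := by
    ext a
    rw [coeff_restrictCoeff, coeff_lastCycleSum (glIncl_mem_basisStabilizer a), coeff_borelSum]
    simp only [glIncl_mem_borel_iff]
  rw [steinbergElt_succ, mul_assoc, ← map_mul]
  exact (restrictCoeff_mul_mapDomain _ _ _).trans (by rw [hrestrict, steinbergElt, mul_assoc])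

lemma coeff_steinbergElt_mul_glInclAlg_eq_zero {h : GLp p (n + 1)}
    (hh : h ∈ basisStabilizer p (Fin.last n)) (hrange : h ∉ (glIncl p n).range) (x : GrpAlg p n) :
    (steinbergElt p (n + 1) * glInclAlg p n x).coeff h = 0 := by
  classical
  rw [steinbergElt_succ, mul_assoc, ← map_mul]
  refine coeff_mul_mapDomain_eq_zero _ (fun a => ?_) _
  have hmem := mul_mem hh (glIncl_mem_basisStabilizer a)
  rw [coeff_lastCycleSum hmem, if_neg fun hb => hrange ?_]
  exact (Subgroup.mul_mem_cancel_right _ (MonoidHom.mem_range.2 ⟨a, rfl⟩)).1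
    (mem_range_glIncl_of_mem_borel hmem hb)

lemma restrictCoeff_steinbergElt_mul_glInclAlg_mul_eq_zero {h : GLp p (n + 1)}
    (hh : h ∈ basisStabilizer p (Fin.last n)) (hrange : h ∉ (glIncl p n).range) (x : GrpAlg p n) :
    restrictCoeff (glIncl p n) glIncl_injective
      (steinbergElt p (n + 1) * glInclAlg p n x * δ h) = 0 := by
  ext a
  have hmem := mul_mem (glIncl_mem_basisStabilizer a) (inv_mem hh)
  have hrange' : glIncl p n a * h⁻¹ ∉ (glIncl p n).range := by
    rwa [Subgroup.mul_mem_cancel_left _ (MonoidHom.mem_range.2 ⟨a, rfl⟩), inv_mem_iff]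
  simpa [coeff_restrictCoeff] using coeff_steinbergElt_mul_glInclAlg_eq_zero hmem hrange' x

end Inclusion

section DualJ

variable {p n : ℕ}

/-- The class in `J(V_n)` of the indicator function of `v`. -/
def indicatorClass (v : Fin n → ZMod p) : Fun p n ⧸ constFun p n :=
  (constFun p n).mkQ (Pi.single v 1)

/-- The functional `φ ↦ φ v - φ 0` on `J(V_n)`. For `v ≠ 0` these form the basis of `J(V_n)^#`
dual to the indicator classes. -/
def evalSub (v : Fin n → ZMod p) : Module.Dual (ZMod p) (Fun p n ⧸ constFun p n) :=
  (constFun p n).liftQ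
    { toFun φ := φ v - φ 0
      map_add' φ χ := add_sub_add_comm _ _ _ _
      map_smul' c φ := (mul_sub _ _ _).symm } (by
    rintro _ ⟨c, rfl⟩
    exact sub_self c)

lemma evalSub_mkQ (v : Fin n → ZMod p) (φ : Fun p n) :
    evalSub v ((constFun p n).mkQ φ) = φ v - φ 0 := rfl

lemma evalSub_zero : evalSub (0 : Fin n → ZMod p) = 0 :=
  Submodule.linearMap_qext _ (LinearMap.ext fun φ => sub_self (φ 0))

lemma evalSub_indicatorClass (v : Fin n → ZMod p) {w : Fin n → ZMod p} (hw : w ≠ 0) :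
    evalSub v (indicatorClass w) = if v = w then 1 else 0 := by
  rw [indicatorClass, evalSub_mkQ, Pi.single_apply, Pi.single_apply, if_neg hw.symm, sub_zero]

lemma dual_J_apply_evalSub (g : GLp p n) (v : Fin n → ZMod p) :
    (J p n).dual (.op g) (evalSub v) = evalSub (g⁻¹ • v) := by
  refine Submodule.linearMap_qext _ (LinearMap.ext fun φ => ?_)
  change φ (g⁻¹ • v) - φ (g⁻¹ • (0 : Fin n → ZMod p)) = φ (g⁻¹ • v) - φ 0
  rw [smul_zero]

variable [Fact p.Prime]

lemma dual_eq_sum_evalSub (f : Module.Dual (ZMod p) (Fun p n ⧸ constFun p n)) :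
    f = ∑ v, f (indicatorClass v) • evalSub v := by
  have hφ (φ : Fun p n) : f ((constFun p n).mkQ φ) = ∑ v, f (indicatorClass v) * φ v := by
    conv_lhs => rw [pi_eq_sum_univ' φ]
    simp [indicatorClass, mul_comm]
  have hsum : ∑ v, f (indicatorClass v) = 0 := by
    have hone : (constFun p n).mkQ 1 = 0 := (Submodule.Quotient.mk_eq_zero _).2 ⟨1, rfl⟩
    simpa [hone] using (hφ 1).symm
  refine Submodule.linearMap_qext _ (LinearMap.ext fun φ => ?_)
  simp [-Submodule.mkQ_apply, hφ, evalSub_mkQ, mul_sub, ← Finset.sum_mul, hsum]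

lemma exists_smul_single_eq (l : Fin n) {v : Fin n → ZMod p} (hv : v ≠ 0) :
    ∃ g : GLp p n, g • (Pi.single l 1 : Fin n → ZMod p) = v := by
  obtain ⟨i, hi⟩ := Function.ne_iff.1 hv
  let s : Equiv.Perm (Fin n) := Equiv.swap i l
  let M : Matrix (Fin n) (Fin n) (ZMod p) := (1 : Matrix _ _ _).updateCol l (v ∘ s)
  have hM : M.det ≠ 0 := by
    rw [← Matrix.cramer_apply, Matrix.cramer_one]
    simpa [s] using hi
  refine ⟨permGL p n s * Matrix.GeneralLinearGroup.mkOfDetNeZero M hM, ?_⟩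
  rw [mul_smul, permGL_smul]
  change M.mulVec _ ∘ _ = _
  ext r
  simp [M, s]

lemma span_evalSub_smul_single (l : Fin n) : Submodule.span (ZMod p)
    (Set.range fun g : GLp p n => evalSub (g • (Pi.single l 1 : Fin n → ZMod p))) = ⊤ := by
  refine Submodule.eq_top_iff'.2 fun f => ?_
  rw [dual_eq_sum_evalSub f]
  refine Submodule.sum_mem _ fun v _ => Submodule.smul_mem _ _ ?_
  obtain rfl | hv := eq_or_ne v 0
  · rw [evalSub_zero]
    exact zero_mem _
  · obtain ⟨g, rfl⟩ := exists_smul_single_eq l hv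
    exact Submodule.subset_span ⟨g, rfl⟩

end DualJ

section Comparison

open Representation

variable {p n : ℕ} [Fact p.Prime]

/-- The underlying space of `J(V_n)^# ⊗ St_n`. -/
abbrev DualJTensorSt (p n : ℕ) [Fact p.Prime] : Type :=
  Module.Dual (ZMod p) (Fun p n ⧸ constFun p n) ⊗[ZMod p] steinbergIdeal p n

/-- The right `GL_n(𝔽_p)`-module `J(V_n)^# ⊗ St_n`. -/
abbrev dualJTensorSt (p n : ℕ) [Fact p.Prime] : RightRep p n (DualJTensorSt p n) :=
  tprod (J p n).dual (St p n)

/-- The last standard basis vector of `V_{n+1}`, whose stabilizer contains `GL_n(𝔽_p)`. -/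
abbrev lastVec (p n : ℕ) : Fin (n + 1) → ZMod p := Pi.single (Fin.last n) 1

lemma St_stProj (g : GLp p n) (x : GrpAlg p n) :
    St p n (.op g) (stProj p n x) = stProj p n (x * δ g) :=
  Subtype.ext (mul_assoc _ _ _)

lemma span_stProj_basisStabilizer_mul (l : Fin n) (g : GLp p n) : Submodule.span (ZMod p)
    (Set.range fun h : basisStabilizer p l => stProj p n (δ ((h : GLp p n) * g))) = ⊤ := by
  have hmap := congrArg (Submodule.map (St p n (.op g))) (span_stProj_basisStabilizer l)
  rw [Submodule.map_span, ← Set.range_comp, Submodule.map_top,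
    LinearMap.range_eq_top.2 ((St p n).apply_bijective (.op g)).2] at hmap
  simpa only [Function.comp_def, St_stProj, ← map_mul] using hmap

lemma dualJTensorSt_evalSub_tmul (g : GLp p n) (v : Fin n → ZMod p) (x : GrpAlg p n) :
    dualJTensorSt p n (.op g) (evalSub v ⊗ₜ stProj p n x) =
      evalSub (g⁻¹ • v) ⊗ₜ stProj p n (x * δ g) := by
  rw [Representation.tprod_apply, TensorProduct.map_tmul, dual_J_apply_evalSub, St_stProj]

variable (p n) in
lemma exists_linearMap_stProj_glInclAlg :
    ∃ ψ : steinbergIdeal p n →ₗ[ZMod p] steinbergIdeal p (n + 1),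
      ∀ x, ψ (stProj p n x) = stProj p (n + 1) (glInclAlg p n x) := by
  obtain ⟨d, hd⟩ := exists_steinbergElt_succ_eq_mul (p := p) (n := n)
  have hmul (x : GrpAlg p n) : d * glInclAlg p n (steinbergElt p n * x) =
      steinbergElt p (n + 1) * glInclAlg p n x := by
    rw [map_mul, ← mul_assoc, ← hd]
  refine ⟨(LinearMap.mulLeft (ZMod p) d ∘ₗ (glInclAlg p n).toLinearMap ∘ₗ
    (steinbergIdeal p n).subtype).codRestrict _ ?_, fun x => Subtype.ext (hmul x)⟩
  rintro ⟨_, x, rfl⟩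
  exact ⟨glInclAlg p n x, (hmul x).symm⟩

variable (p n) in
lemma exists_intertwiningMap_dualJTensorSt : ∃ f : IntertwiningMap (St p n)
    ((dualJTensorSt p (n + 1)).comp (MonoidHom.op (glIncl p n))),
      ∀ x, f (stProj p n x) =
        evalSub (lastVec p n) ⊗ₜ stProj p (n + 1) (glInclAlg p n x) := by
  obtain ⟨ψ, hψ⟩ := exists_linearMap_stProj_glInclAlg p n
  let f := TensorProduct.mk (ZMod p) _ _ (evalSub (lastVec p n)) ∘ₗ ψ
  have hf (x : GrpAlg p n) : f (stProj p n x) =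
      evalSub (lastVec p n) ⊗ₜ stProj p (n + 1) (glInclAlg p n x) := by
    simp [f, hψ]
  refine ⟨⟨f, fun g => LinearMap.ext (stProj_surjective.forall.2 fun x => ?_)⟩, hf⟩
  have hstab : (glIncl p n g.unop)⁻¹ • lastVec p n = lastVec p n :=
      inv_mem (glIncl_mem_basisStabilizer g.unop)
  change f (St p n (.op g.unop) _) =
    dualJTensorSt p (n + 1) (.op (glIncl p n g.unop)) (f _)
  rw [St_stProj, hf, hf, dualJTensorSt_evalSub_tmul, hstab, map_mul, glInclAlg_of]

lemma iSup_range_dualJTensorSt_comp_eq_top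
    {f : steinbergIdeal p n →ₗ[ZMod p] DualJTensorSt p (n + 1)}
    (hf : f (stProj p n 1) = evalSub (lastVec p n) ⊗ₜ stProj p (n + 1) 1) :
    ⨆ h, LinearMap.range (dualJTensorSt p (n + 1) h ∘ₗ f) = ⊤ := by
  set R := ⨆ h, LinearMap.range (dualJTensorSt p (n + 1) h ∘ₗ f)
  have hR (g : GLp p (n + 1)) : evalSub (g⁻¹ • lastVec p n) ⊗ₜ stProj p (n + 1) (δ g) ∈ R := by
    refine Submodule.mem_iSup_of_mem (.op g) ⟨stProj p n 1, ?_⟩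
    rw [LinearMap.comp_apply, hf, dualJTensorSt_evalSub_tmul, one_mul]
  have htmul (g : GLp p (n + 1)) :
      ⊤ ≤ R.comap (TensorProduct.mk (ZMod p) _ _ (evalSub (g • lastVec p n))) := by
    rw [← span_stProj_basisStabilizer_mul (Fin.last n) g⁻¹, Submodule.span_le]
    rintro _ ⟨h, rfl⟩
    have hh : (h : GLp p (n + 1))⁻¹ • lastVec p n = lastVec p n := inv_mem h.2
    have hmem := hR (h * g⁻¹)
    rwa [mul_inv_rev, inv_inv, mul_smul, hh] at hmem
  rw [eq_top_iff, ← TensorProduct.map₂_mk_top_top_eq_top, Submodule.map₂_le]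
  intro φ _ y _
  suffices hφ : ⊤ ≤ R.comap ((TensorProduct.mk (ZMod p) _ _).flip y) from hφ (x := φ) trivial
  rw [← span_evalSub_smul_single (Fin.last n), Submodule.span_le]
  rintro _ ⟨g, rfl⟩
  exact htmul g (x := y) trivial

variable (p n) in
/-- The coefficient at the last basis vector, followed by restriction of coefficients to the image
of `GL_n(𝔽_p)`. -/
def stabRestrict : DualJTensorSt p (n + 1) →ₗ[ZMod p] GrpAlg p n :=
  TensorProduct.lift ((LinearMap.lsmul (ZMod p) (GrpAlg p n)).compl₁₂
    (LinearMap.applyₗ (indicatorClass (lastVec p n)))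
    (restrictCoeff (glIncl p n) glIncl_injective ∘ₗ (steinbergIdeal p (n + 1)).subtype))

lemma stabRestrict_evalSub_tmul (v : Fin (n + 1) → ZMod p) (x : GrpAlg p (n + 1)) :
    stabRestrict p n (evalSub v ⊗ₜ stProj p (n + 1) x) =
      if v = lastVec p n then
        restrictCoeff (glIncl p n) glIncl_injective (steinbergElt p (n + 1) * x) else 0 := by
  have hsmul : stabRestrict p n (evalSub v ⊗ₜ stProj p (n + 1) x) =
      evalSub v (indicatorClass (lastVec p n)) •
        restrictCoeff (glIncl p n) glIncl_injective (steinbergElt p (n + 1) * x) := rfl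
  rw [hsmul, evalSub_indicatorClass v (by simp), ite_smul, one_smul, zero_smul]

lemma stabRestrict_evalSub_lastVec_tmul (x : GrpAlg p n) :
    stabRestrict p n (evalSub (lastVec p n) ⊗ₜ stProj p (n + 1) (glInclAlg p n x)) =
      stProj p n x := by
  rw [stabRestrict_evalSub_tmul, if_pos rfl, restrictCoeff_steinbergElt_mul_glInclAlg]
  rfl

lemma stabRestrict_dualJTensorSt_evalSub_tmul {h : GLp p (n + 1)} (hh : h ∉ (glIncl p n).range)
    (x : GrpAlg p n) :
    stabRestrict p n (dualJTensorSt p (n + 1) (.op h)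
      (evalSub (lastVec p n) ⊗ₜ stProj p (n + 1) (glInclAlg p n x))) = 0 := by
  rw [dualJTensorSt_evalSub_tmul, stabRestrict_evalSub_tmul, ite_eq_right_iff]
  intro hinv
  have hstab : h ∈ basisStabilizer p (Fin.last n) := inv_mem_iff.1 hinv
  rw [← mul_assoc, restrictCoeff_steinbergElt_mul_glInclAlg_mul_eq_zero hstab hh]

end Comparison

end

end GLSteinberg

open GLSteinberg in
theorem lemma4p2 (p : ℕ) [Fact p.Prime] (n : ℕ) :
    Nonempty (Representation.Equiv
      (GLSteinberg.Ind p n (GLSteinberg.St p n))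
      (Representation.tprod (GLSteinberg.J p (n + 1)).dual (GLSteinberg.St p (n + 1)))) := by
  obtain ⟨f, hf⟩ := exists_intertwiningMap_dualJTensorSt p n
  refine nonempty_ind_equiv (B := DualJTensorSt p (n + 1)) f (stabRestrict p n) ?_ ?_ fun h hh => ?_
  · exact iSup_range_dualJTensorSt_comp_eq_top ((hf 1).trans (by rw [map_one]))
  · have hcomp : stabRestrict p n ∘ₗ f.toLinearMap = (steinbergIdeal p n).subtype :=
      LinearMap.ext <| stProj_surjective.forall.2 fun x => by
        simpa [hf] using stabRestrict_evalSub_lastVec_tmul x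
    rw [hcomp]
    exact Subtype.val_injective
  · have hrange : h.unop ∉ (glIncl p n).range := fun ⟨a, ha⟩ =>
      hh ⟨.op a, congrArg MulOpposite.op ha⟩
    refine LinearMap.ext <| stProj_surjective.forall.2 fun x => ?_
    simpa [hf] using stabRestrict_dualJTensorSt_evalSub_tmul hrange x
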